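/- **Conventions.** Let $\mathscr{A}$ be an abelian category with enough projective objects; all subcategories are full. For a subcategory $\mathscr{T}$ of $\mathscr{A}$ let $\mathrm{Fac}(\mathscr{T})$ be the subcategory of all quotients of objects of $\mathscr{T}$; for a class of objects $\mathscr{X}$ let $\mathrm{add}\,\mathscr{X}$ be the subcategory of all direct summands of finite direct sums of objects of $\mathscr{X}$. A morphism $f: A\to T$ is a left $\mathscr{T}$-approximation if $T\in\mathscr{T}$ and every morphism from $A$ to an object of $\mathscr{T}$ factors through $f$; right $\mathscr{T}$-approximations $T\to A$ are defined dually, and $\mathscr{T}$ is contravariantly finite if every object of $\mathscr{A}$ has a right $\mathscr{T}$-approximation. An additive (that is, closed under finite direct sums) contravariantly finite subcategory $\mathscr{T}$ is called *support $\tau$-tilting* if 1. $\mathrm{Ext}^1_{\mathscr{A}}(T, Y)=0$ for all $T\in\mathscr{T}$ and $Y\in\mathrm{Fac}(\mathscr{T})$, and 2. for every projective object $P$ of $\mathscr{A}$ there is an exact sequence $P\xrightarrow{f}T^0\to T^1\to 0$ with $T^0,T^1\in\mathscr{T}$ such that $f$ is a left $\mathscr{T}$-approximation of $P$. For a finite acyclic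 quiver $Q$ with vertex set $Q_0$, let $\mathrm{Rep}(Q,\mathscr{A})$ be the category of representations of $Q$ in $\mathscr{A}$, which is again abelian with enough projective objects. For $i\in Q_0$ let $e_i^\rho:\mathscr{A}\to\mathrm{Rep}(Q,\mathscr{A})$ be the right adjoint of the evaluation functor $X\mapsto X_i$; explicitly, $e_i^\rho(T)_j=\bigoplus_{Q(j,i)}T$, where $Q(j,i)$ is the set of paths from $j$ to $i$, and the arrows act by the natural projections. **Theorem.** Let $\mathscr{A}$ be an abelian category with enough projective objects and let $Q$ be a finite acyclic quiver. Let $\mathscr{T}$ be a support $\tau$-tilting subcategory of $\mathscr{A}$ such that $\mathrm{Fac}(\mathscr{T})$ is closed under kernels of epimorphisms, i.e. the kernel of every epimorphism of $\mathscr{A}$ between objects of $\mathrm{Fac}(\mathscr{T})$ lies in $\mathrm{Fac}(\mathscr{T})$. Then $$\mathbb{T}=\mathrm{add}\{e_i^\rho(T) : i\in Q_0,\ T\in\mathscr{T}\}$$ is a support $\tau$-tilting subcategory of $\mathrm{Rep}(Q,\mathscr{A})$. -/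

import Mathlib

open CategoryTheory CategoryTheory.Limits CategoryTheory.Abelian

universe w' w v u

namespace TauTilting

section Subcategories

/-! Full subcategories of `C` are given by `ObjectProperty C`. -/

variable {C : Type u} [Category.{v} C]

/-- `φ : X ⟶ A` is a right `𝒳`-approximation of `A`: `X ∈ 𝒳` and every morphism from an object
of `𝒳` to `A` factors through `φ`. -/
def IsRightApproximation (𝒳 : ObjectProperty C) {X A : C} (φ : X ⟶ A) : Prop :=
  𝒳 X ∧ ∀ ⦃X' : C⦄, 𝒳 X' → ∀ h : X' ⟶ A, ∃ k : X' ⟶ X, k ≫ φ = h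

/-- `φ : A ⟶ X` is a left `𝒳`-approximation of `A`: `X ∈ 𝒳` and every morphism from `A` to an
object of `𝒳` factors through `φ`. -/
def IsLeftApproximation (𝒳 : ObjectProperty C) {A X : C} (φ : A ⟶ X) : Prop :=
  𝒳 X ∧ ∀ ⦃X' : C⦄, 𝒳 X' → ∀ h : A ⟶ X', ∃ k : X ⟶ X', φ ≫ k = h

/-- Every object of `C` admits a right `𝒳`-approximation. -/
def IsContravariantlyFinite (𝒳 : ObjectProperty C) : Prop :=
  ∀ A : C, ∃ (X : C) (φ : X ⟶ A), IsRightApproximation 𝒳 φ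

/-- The full subcategory of factor objects (quotients) of objects of `𝒯`. -/
def Fac (𝒯 : ObjectProperty C) : ObjectProperty C :=
  fun Y => ∃ (T : C) (π : T ⟶ Y), 𝒯 T ∧ Epi π

variable [Abelian C]

/-- The full subcategory of direct summands of finite direct sums of objects of `P`. -/
def add (P : ObjectProperty C) : ObjectProperty C :=
  fun X => ∃ (n : ℕ) (F : Fin n → C), (∀ k, P (F k)) ∧ Nonempty (Retract X (∐ F))

/-- If `f : X ⟶ Y` is an epimorphism with `X` and `Y` in `P`, then its kernel is in `P`. -/
def IsClosedUnderKernelsOfEpis (P : ObjectProperty C) : Prop :=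
  ∀ ⦃X Y : C⦄ (f : X ⟶ Y), Epi f → P X → P Y → P (kernel f)

/-- `Ext¹(X, Y) = 0`. -/
def ExtOneVanishes (X Y : C) : Prop :=
  letI := HasExt.standard C
  Subsingleton (Ext.{max u v} X Y 1)

/-- Support `τ`-tilting subcategories of an abelian category with enough projective objects. -/
structure IsSupportTauTilting [EnoughProjectives C] (𝒯 : ObjectProperty C) : Prop where
  /-- `𝒯` is an additive full subcategory: it is closed under (all, including empty) finite
  direct sums. -/
  additive : 𝒯.IsClosedUnderFiniteCoproducts
  /-- `𝒯` is contravariantly finite in `C`. -/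
  contravariantlyFinite : IsContravariantlyFinite 𝒯
  /-- `Ext¹(T₁, Fac T₂) = 0` for all `T₁, T₂ ∈ 𝒯`. As `𝒯` is additive, the objects of the
  categories `Fac T₂` with `T₂ ∈ 𝒯` are exactly the objects of `Fac 𝒯`. -/
  ext_vanishes : ∀ ⦃T Y : C⦄, 𝒯 T → Fac 𝒯 Y → ExtOneVanishes T Y
  /-- Every projective `P` has an exact sequence `P ⟶ T⁰ ⟶ T¹ ⟶ 0` with `T⁰, T¹ ∈ 𝒯` whose first
  morphism is a left `𝒯`-approximation of `P`. -/
  exists_sequence : ∀ P : C, Projective P →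
    ∃ (T₀ T₁ : C) (f : P ⟶ T₀) (g : T₀ ⟶ T₁) (w : f ≫ g = 0),
      𝒯 T₀ ∧ 𝒯 T₁ ∧ (ShortComplex.mk f g w).Exact ∧ Epi g ∧ IsLeftApproximation 𝒯 f

end Subcategories

section Quivers

/-- A quiver is finite: finitely many vertices and finitely many arrows. -/
class IsFiniteQuiver (Q : Type w) [Quiver.{w'} Q] : Prop where
  finite_vertices : Finite Q
  finite_arrows : ∀ i j : Q, Finite (i ⟶ j)

/-- A quiver is acyclic: it has no oriented cycles, that is, every path from a vertex to itself
has length zero. -/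
class IsAcyclicQuiver (Q : Type w) [Quiver.{w'} Q] : Prop where
  length_eq_zero : ∀ (i : Q) (p : Quiver.Path i i), p.length = 0

theorem finite_path (Q : Type w) [Quiver.{w'} Q] [IsFiniteQuiver Q] [IsAcyclicQuiver Q]
    (i j : Q) : Finite (Quiver.Path i j) := by
  have : Finite Q := IsFiniteQuiver.finite_vertices
  have : ∀ i j : Q, Finite (i ⟶ j) := IsFiniteQuiver.finite_arrows
  let r : Q → Q → Prop := fun a b => ∃ p : Quiver.Path a b, 0 < p.length
  have : IsTrans Q r := ⟨fun a b c ⟨p, hp⟩ ⟨q, hq⟩ => ⟨p.comp q, by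
    rw [Quiver.Path.length_comp]; omega⟩⟩
  have : Std.Irrefl r := ⟨fun a ⟨p, hp⟩ => by
    have := IsAcyclicQuiver.length_eq_zero a p; omega⟩
  have wf : WellFounded r := Finite.wellFounded_of_trans_of_irrefl r
  induction j using wf.induction with
  | _ j ih =>
    have : ∀ c : Q, Finite (Quiver.Path i c × (c ⟶ j)) := fun c => by
      by_cases h : Nonempty (c ⟶ j)
      · obtain ⟨e⟩ := h
        have := ih c ⟨e.toPath, by simp⟩
        infer_instance
      · have : IsEmpty (c ⟶ j) := not_nonempty_iff.mp h
        infer_instance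
    let f : Option (Σ c : Q, Quiver.Path i c × (c ⟶ j)) → Option (Quiver.Path i j) := fun x =>
      x.map fun y => y.2.1.cons y.2.2
    have hf : ∀ p : Quiver.Path i j, 0 < p.length → ∃ x, f x = some p := by
      intro p hp
      cases p with
      | nil => simp at hp
      | cons p e => exact ⟨some ⟨_, p, e⟩, rfl⟩
    have h1 : Finite {p : Quiver.Path i j // 0 < p.length} := by
      choose g hg using hf
      refine Finite.of_injective (fun p : {p : Quiver.Path i j // 0 < p.length} => g p.1 p.2) ?_
      intro p q hpq
      have h2 : f (g p.1 p.2) = f (g q.1 q.2) := congrArg f hpq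
      rw [hg, hg] at h2
      exact Subtype.ext (Option.some.inj h2)
    have h2 : Finite {p : Quiver.Path i j // ¬ 0 < p.length} := by
      have : Subsingleton {p : Quiver.Path i j // ¬ 0 < p.length} := by
        refine ⟨?_⟩
        rintro ⟨p, hp⟩ ⟨q, hq⟩
        apply Subtype.ext
        cases p with
        | nil =>
          exact (Quiver.Path.eq_nil_of_length_zero q (by omega)).symm
        | cons p e => simp at hp
      infer_instance
    exact Finite.of_equiv _ (Equiv.sumCompl fun p : Quiver.Path i j => 0 < p.length)

variable (Q : Type w) [Quiver.{w'} Q] (A : Type u) [Category.{v} A]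

/-- The category of representations of the quiver `Q` in `A`. A functor from the path category of
`Q` amounts to an object of `A` for every vertex and a morphism of `A` for every arrow
(`CategoryTheory.Paths.lift`); a natural transformation amounts to a family of morphisms indexed by
the vertices which is compatible with the arrows. -/
abbrev QuiverRep := Paths Q ⥤ A

variable {Q A}

/-- The evaluation functor `e_i : Rep(Q, A) ⥤ A`, `X ↦ X_i`. -/
abbrev eval (i : Q) : QuiverRep Q A ⥤ A :=
  (evaluation (Paths Q) A).obj i

variable [Abelian A] [IsFiniteQuiver Q] [IsAcyclicQuiver Q]

instance finite_paths_hom (i j : Paths Q) : Finite (i ⟶ j) :=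
  finite_path Q i j

instance hasProductsOfShape_paths_hom (i j : Paths Q) : HasProductsOfShape (i ⟶ j) A :=
  inferInstance

instance hasCoproductsOfShape_paths_hom (i j : Paths Q) : HasCoproductsOfShape (i ⟶ j) A :=
  inferInstance

/-- The functor `e_i^ρ : A ⥤ Rep(Q, A)`: `e_i^ρ(T)_j` is the (finite) direct sum of copies of `T`
indexed by the paths from `j` to `i`, and the morphisms along the arrows are the projections. -/
noncomputable abbrev eRho (i : Q) : A ⥤ QuiverRep Q A :=
  evaluationRightAdjoint (C := Paths Q) A i

/-- `e_i^ρ` is right adjoint to the evaluation functor `e_i`. -/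
noncomputable def evalAdjunction (i : Q) : eval (A := A) i ⊣ eRho i :=
  evaluationAdjunctionLeft (C := Paths Q) A i

/-- The objects `e_i^ρ(T)` of `Rep(Q, A)`, where `i` is a vertex of `Q` and `T ∈ 𝒯`. -/
def rhoObjects (Q : Type w) [Quiver.{w'} Q] [IsFiniteQuiver Q] [IsAcyclicQuiver Q]
    (𝒯 : ObjectProperty A) : ObjectProperty (QuiverRep Q A) :=
  fun X => ∃ (i : Q) (T : A), 𝒯 T ∧ X = (eRho i).obj T

/-- The category of representations of a finite acyclic quiver in an abelian category with enough
projective objects has enough projective objects. -/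
instance enoughProjectives_quiverRep [EnoughProjectives A] :
    EnoughProjectives (QuiverRep Q A) where
  presentation X := by
    have : Finite Q := IsFiniteQuiver.finite_vertices
    let adj := fun i : Q => evaluationAdjunctionRight (C := Paths Q) A i
    let L : Q → QuiverRep Q A := fun i =>
      (evaluationLeftAdjoint (C := Paths Q) A i).obj (Projective.over (X.obj i))
    let φ : ∀ i : Q, L i ⟶ X := fun i =>
      ((adj i).homEquiv _ _).symm (Projective.π (X.obj i))
    have hL : ∀ i, Projective (L i) := fun i => by
      have : (eval (A := A) i).PreservesEpimorphisms :=
        Functor.preservesEpimorphisms_of_adjunction (evalAdjunction i)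
      exact (adj i).map_projective _ inferInstance
    have hproj : Projective (∐ L) := by
      refine ⟨fun {E Y} f e he => ?_⟩
      refine ⟨Sigma.desc fun i => Projective.factorThru (Sigma.ι L i ≫ f) e, ?_⟩
      refine Sigma.hom_ext _ _ fun i => ?_
      rw [← Category.assoc, Sigma.ι_desc, Projective.factorThru_comp]
    have hepi : Epi (Sigma.desc φ) := by
      refine ⟨fun {Z} g h hgh => ?_⟩
      ext i
      have h1 : φ i ≫ g = φ i ≫ h := by
        have := congrArg (fun t => Sigma.ι L i ≫ t) hgh
        simpa using this
      have h2 := congrArg ((adj i).homEquiv _ _) h1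
      rw [Adjunction.homEquiv_naturality_right, Adjunction.homEquiv_naturality_right] at h2
      simp only [φ, Equiv.apply_symm_apply] at h2
      exact (cancel_epi (Projective.π (X.obj i))).1 h2
    exact ⟨{ p := ∐ L, projective := hproj, f := Sigma.desc φ, epi := hepi }⟩

end Quivers

end TauTilting

namespace TauTilting

attribute [local instance] Abelian.hasFiniteBiproducts

/-! ### Quotients of objects of a subcategory -/

section Factor

variable {C : Type u} [Category.{v} C]

/-! Write 𝕋 for the additive closure of the objects `e_i^ρ(T)`. The heart is
`extOneVanishes_of_fac_add_rhoObjects`: `Ext¹(N, M) = 0` if every `N_i` is in `add 𝒯` and `M` is in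
`Fac 𝕋`. For such `M` the map from `M_i` to the product of the `M_j` over the arrows `i ⟶ j` is epi
(`epi_outMap_coind`, `epi_outMap_of_fac_add`), and its kernel is in `Fac 𝒯` because `Fac 𝒯` is
closed under kernels of epimorphisms. An extension of `N` by `M` splits at each vertex, and these
kernels carry the obstructions to making the sections compatible with the arrows; they vanish,
working backwards from the sinks.

Contravariant finiteness holds because `T ↦ Hom(e_i^ρ(T), X)` is controlled by a single object `R`
of `A` (`exists_universal_from_coind`), which has a right `𝒯`-approximation.

For a projective `P`, left approximations of the `P_i` give by adjunction a left 𝕋-approximation `f`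
of `P`. Its cokernel `C` is in `add 𝒯` at each vertex (`IsSupportTauTilting.add_cokernel`). The unit
`C ⟶ ⨁ e_i^ρ(C_i)` splits at each vertex, so its cokernel is also in `add 𝒯` there. Since `C` is in
`Fac 𝕋`, the Ext statement splits the unit globally, and `C` is in 𝕋.

As `𝒯` need not be closed under direct summands, the vertexwise statements use `add 𝒯`. -/

theorem fac_of_epi {P : ObjectProperty C} {X Y : C} (hX : Fac P X) (f : X ⟶ Y) [Epi f] :
    Fac P Y := by
  obtain ⟨T, π, hT, hπ⟩ := hX
  exact ⟨T, π ≫ f, hT, epi_comp _ _⟩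

end Factor

/-! ### Additive closures and cokernels of approximations -/

section AdditiveClosure

variable {C : Type u} [Category.{v} C] [Abelian C]

/-- Decomposing the identity is a condition on morphisms only, so additive functors preserve it and
closure properties become computations with finite sums. -/
theorem add_iff_exists_sum {P : ObjectProperty C} {X : C} :
    add P X ↔ ∃ (n : ℕ) (F : Fin n → C) (p : ∀ k, X ⟶ F k) (q : ∀ k, F k ⟶ X),
      (∀ k, P (F k)) ∧ ∑ k, p k ≫ q k = 𝟙 X := by
  constructor
  · rintro ⟨n, F, hF, ⟨r⟩⟩
    let e : ∐ F ≅ ⨁ F := (biproduct.isoCoproduct F).symm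
    refine ⟨n, F, fun k => r.i ≫ e.hom ≫ biproduct.π F k,
      fun k => biproduct.ι F k ≫ e.inv ≫ r.r, hF, ?_⟩
    have h : ∑ k, (r.i ≫ e.hom ≫ biproduct.π F k) ≫ biproduct.ι F k ≫ e.inv ≫ r.r =
        r.i ≫ e.hom ≫ (∑ k, biproduct.π F k ≫ biproduct.ι F k) ≫ e.inv ≫ r.r := by
      simp only [Preadditive.sum_comp, Preadditive.comp_sum, Category.assoc]
    rw [h, biproduct.total]
    simp
  · rintro ⟨n, F, p, q, hF, h⟩
    let e : ∐ F ≅ ⨁ F := (biproduct.isoCoproduct F).symm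
    refine ⟨n, F, hF, ⟨⟨biproduct.lift p ≫ e.inv, e.hom ≫ biproduct.desc q, ?_⟩⟩⟩
    simp [biproduct.lift_desc, h]

theorem add_of_sum_of_prop {P : ObjectProperty C} {ι : Type*} [Fintype ι] {X : C} (F : ι → C)
    (hF : ∀ k, P (F k)) (p : ∀ k, X ⟶ F k) (q : ∀ k, F k ⟶ X)
    (h : ∑ k, p k ≫ q k = 𝟙 X) : add P X := by
  let e := (Fintype.equivFin ι).symm
  refine add_iff_exists_sum.2 ⟨Fintype.card ι, fun k => F (e k), fun k => p (e k),
    fun k => q (e k), fun k => hF _, ?_⟩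
  rw [← h]
  exact Equiv.sum_comp e fun k => p k ≫ q k

theorem add_of_prop {P : ObjectProperty C} {X : C} (hX : P X) : add P X :=
  add_of_sum_of_prop (ι := Unit) (fun _ => X) (fun _ => hX) (fun _ => 𝟙 X) (fun _ => 𝟙 X) (by simp)

theorem add_of_sum {P : ObjectProperty C} {ι : Type*} [Fintype ι] {X : C} (F : ι → C)
    (hF : ∀ k, add P (F k)) (p : ∀ k, X ⟶ F k) (q : ∀ k, F k ⟶ X)
    (h : ∑ k, p k ≫ q k = 𝟙 X) : add P X := by
  choose n G p' q' hG hsum using fun k => add_iff_exists_sum.1 (hF k)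
  refine add_of_sum_of_prop (ι := Σ k, Fin (n k)) (fun x => G x.1 x.2) (fun x => hG x.1 x.2)
    (fun x => p x.1 ≫ p' x.1 x.2) (fun x => q' x.1 x.2 ≫ q x.1) ?_
  rw [Fintype.sum_sigma, ← h]
  refine Finset.sum_congr rfl fun k _ => ?_
  have h1 : ∑ y, (p k ≫ p' k y) ≫ q' k y ≫ q k = p k ≫ (∑ y, p' k y ≫ q' k y) ≫ q k := by
    simp only [Preadditive.sum_comp, Preadditive.comp_sum, Category.assoc]
  rw [h1, hsum, Category.id_comp]

theorem add_of_retract {P : ObjectProperty C} {X Y : C} (hY : add P Y) (i : X ⟶ Y) (r : Y ⟶ X)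
    (h : i ≫ r = 𝟙 X) : add P X :=
  add_of_sum (ι := Unit) (fun _ => Y) (fun _ => hY) (fun _ => i) (fun _ => r) (by simp [h])

theorem add_of_iso {P : ObjectProperty C} {X Y : C} (hY : add P Y) (e : X ≅ Y) : add P X :=
  add_of_retract hY e.hom e.inv e.hom_inv_id

theorem biproduct_total {ι : Type*} [Fintype ι] (F : ι → C) :
    ∑ k, biproduct.π F k ≫ biproduct.ι F k = 𝟙 (⨁ F) := by
  classical
  refine biproduct.hom_ext' _ _ fun j => ?_
  rw [Preadditive.comp_sum, Finset.sum_eq_single j, biproduct.ι_π_self_assoc, Category.comp_id]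
  · intro k _ hk
    rw [biproduct.ι_π_ne_assoc F hk.symm, zero_comp]
  · simp

theorem add_biproduct {P : ObjectProperty C} {ι : Type*} [Finite ι] (F : ι → C)
    (hF : ∀ k, add P (F k)) : add P (⨁ F) := by
  have := Fintype.ofFinite ι
  exact add_of_sum F hF (biproduct.π F) (biproduct.ι F) (biproduct_total F)

theorem add_isClosedUnderFiniteCoproducts (P : ObjectProperty C) :
    (add P).IsClosedUnderFiniteCoproducts where
  isClosedUnderColimitsOfShape J _ := by
    refine ⟨fun X ⟨h⟩ => ?_⟩
    have : HasColimit (Discrete.functor fun j => h.diag.obj ⟨j⟩) := inferInstance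
    let e : X ≅ ∐ fun j => h.diag.obj ⟨j⟩ :=
      h.isColimit.coconePointUniqueUpToIso (colimit.isColimit h.diag) ≪≫
        HasColimit.isoOfNatIso Discrete.natIsoFunctor
    exact add_of_iso (add_biproduct _ fun j => h.prop_diag_obj ⟨j⟩)
      (e ≪≫ (biproduct.isoCoproduct _).symm)

theorem add_map {D : Type*} [Category* D] [Abelian D] {P : ObjectProperty C} {P' : ObjectProperty D}
    (G : C ⥤ D) [G.Additive] (hG : ∀ X, P X → add P' (G.obj X)) {X : C} (hX : add P X) :
    add P' (G.obj X) := by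
  obtain ⟨n, F, p, q, hF, h⟩ := add_iff_exists_sum.1 hX
  refine add_of_sum (fun k => G.obj (F k)) (fun k => hG _ (hF k)) (fun k => G.map (p k))
    (fun k => G.map (q k)) ?_
  simp only [← G.map_comp, ← G.map_sum, h, G.map_id]

theorem prop_piObj {P : ObjectProperty C} [P.IsClosedUnderFiniteCoproducts] {ι : Type*} [Finite ι]
    (F : ι → C) (hF : ∀ k, P (F k)) : P (∏ᶜ F) :=
  have := ObjectProperty.IsClosedUnderBinaryCoproducts.closedUnderIsomorphisms P
  P.prop_of_iso ((biproduct.isoCoproduct F).symm ≪≫ biproduct.isoProduct F)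
    (P.prop_coproduct hF)

theorem fac_piObj {P : ObjectProperty C} [P.IsClosedUnderFiniteCoproducts] {ι : Type*} [Finite ι]
    (F : ι → C) (hF : ∀ k, Fac P (F k)) : Fac P (∏ᶜ F) := by
  choose T π hT hπ using hF
  have : ∀ k, Epi (π k) := hπ
  exact ⟨∏ᶜ T, Limits.Pi.map π, prop_piObj T hT, inferInstance⟩

theorem fac_of_add {P : ObjectProperty C} [P.IsClosedUnderFiniteCoproducts] {X : C}
    (hX : add P X) : Fac P X := by
  obtain ⟨n, F, hF, ⟨r⟩⟩ := hX
  exact ⟨∐ F, r.r, P.prop_coproduct hF, inferInstance⟩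

theorem exists_factor_of_add {P : ObjectProperty C} {A X : C} (f : A ⟶ X)
    (hf : ∀ ⦃T : C⦄, P T → ∀ h : A ⟶ T, ∃ k : X ⟶ T, f ≫ k = h) {T : C} (hT : add P T)
    (h : A ⟶ T) : ∃ k : X ⟶ T, f ≫ k = h := by
  obtain ⟨n, F, p, q, hF, hsum⟩ := add_iff_exists_sum.1 hT
  choose k hk using fun j => hf (hF j) (h ≫ p j)
  refine ⟨∑ j, k j ≫ q j, ?_⟩
  simp only [Preadditive.comp_sum, reassoc_of% hk]
  rw [← Preadditive.comp_sum, hsum, Category.comp_id]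

theorem exists_lift_of_add {P : ObjectProperty C} {A X : C} (f : X ⟶ A)
    (hf : ∀ ⦃T : C⦄, P T → ∀ h : T ⟶ A, ∃ k : T ⟶ X, k ≫ f = h) {T : C} (hT : add P T)
    (h : T ⟶ A) : ∃ k : T ⟶ X, k ≫ f = h := by
  obtain ⟨n, F, p, q, hF, hsum⟩ := add_iff_exists_sum.1 hT
  choose k hk using fun j => hf (hF j) (q j ≫ h)
  refine ⟨∑ j, p j ≫ k j, ?_⟩
  simp only [Preadditive.sum_comp, Category.assoc, hk]
  simp only [← Category.assoc]
  rw [← Preadditive.sum_comp, hsum, Category.id_comp]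

/-- The cokernel of an approximation of a projective object lies in the additive closure of a
support `τ`-tilting subcategory. -/
theorem IsSupportTauTilting.add_cokernel [EnoughProjectives C] {𝒯 : ObjectProperty C}
    (h𝒯 : IsSupportTauTilting 𝒯) {P X : C} (hP : Projective P) (f : P ⟶ X) (hX : add 𝒯 X)
    (hf : ∀ ⦃T : C⦄, 𝒯 T → ∀ h : P ⟶ T, ∃ k : X ⟶ T, f ≫ k = h) : add 𝒯 (cokernel f) := by
  obtain ⟨T₀, T₁, f₀, g₀, w, hT₀, hT₁, hex, hg₀, -, hf₀⟩ := h𝒯.exists_sequence P hP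
  obtain ⟨u, hu⟩ := exists_factor_of_add f₀ hf₀ hX f
  obtain ⟨k, hk⟩ := hf hT₀ f₀
  have hg₀' : Epi (ShortComplex.mk f₀ g₀ w).g := hg₀
  let v : T₁ ⟶ cokernel f := hex.desc (u ≫ cokernel.π f) (by
    simp [reassoc_of% hu])
  have hv : g₀ ≫ v = u ≫ cokernel.π f := hex.g_desc _ _
  -- `f` and `f₀` factor through each other, via `k` and `u`. This makes `cokernel f` a summand of
  -- `X ⊕ T₁`: after `cokernel.π f`, the part through `X` gives `(𝟙 - k ≫ u) ≫ π`, and the part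
  -- through `T₁` restores `k ≫ u ≫ π`.
  let s₁ : cokernel f ⟶ X := cokernel.desc f (𝟙 X - k ≫ u) (by simp [reassoc_of% hk, hu])
  let s₂ : cokernel f ⟶ T₁ := cokernel.desc f (k ≫ g₀) (by simp [reassoc_of% hk, w])
  refine add_of_sum (ι := Bool) (fun b => cond b X T₁)
    (fun b => by cases b; exacts [add_of_prop hT₁, hX])
    (fun b => match b with | true => s₁ | false => s₂)
    (fun b => match b with | true => cokernel.π f | false => v) ?_
  rw [Fintype.sum_bool, ← cancel_epi (cokernel.π f)]
  simp [s₁, s₂, hv]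

end AdditiveClosure

/-! ### Vanishing of `Ext¹`, lifts and split extensions -/

section ExtLifting

variable {C : Type u} [Category.{v} C] [Abelian C]

theorem ExtOneVanishes.exists_lift {X E N : C} (g : E ⟶ N) [Epi g]
    (h : ExtOneVanishes X (kernel g)) (f : X ⟶ N) : ∃ k : X ⟶ E, k ≫ g = f := by
  let _ := HasExt.standard C
  let S := ShortComplex.mk (kernel.ι g) g (kernel.condition g)
  have hS : S.ShortExact :=
    { exact := ShortComplex.exact_kernel g
      epi_g := (inferInstance : Epi g) }
  have : Subsingleton (Ext.{max u v} X (kernel g) 1) := h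
  obtain ⟨x, hx⟩ := Ext.covariant_sequence_exact₃ X hS (Ext.mk₀ f) (zero_add 1)
    (Subsingleton.elim (α := Ext.{max u v} X (kernel g) 1) _ _)
  obtain ⟨k, rfl⟩ := (Ext.mk₀_bijective X E).2 x
  refine ⟨k, (Ext.mk₀_bijective X N).1 ?_⟩
  rw [← hx, Ext.mk₀_comp_mk₀]

/-- By dimension shift along a projective presentation of `X`, a class is the connecting image of
some `φ` from the syzygy to `Y`. Splitting the pushout extension along `φ` extends `φ` to the
projective, so the class is zero. -/
theorem extOneVanishes_of_exists_section [EnoughProjectives C] {X Y : C}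
    (h : ∀ (E : C) (i : Y ⟶ E) (p : E ⟶ X) (w : i ≫ p = 0),
      (ShortComplex.mk i p w).ShortExact → ∃ s : X ⟶ E, s ≫ p = 𝟙 X) :
    ExtOneVanishes X Y := by
  let _ := HasExt.standard C
  suffices ∀ x : Ext.{max u v} X Y 1, x = 0 from ⟨fun a b => by rw [this a, this b]⟩
  intro x
  let g := Projective.π X
  let S := ShortComplex.mk (kernel.ι g) g (kernel.condition g)
  have hS : S.ShortExact :=
    { exact := ShortComplex.exact_kernel g
      epi_g := (inferInstance : Epi g) }
  obtain ⟨y, rfl⟩ := Ext.contravariant_sequence_exact₃ hS Y x (Ext.eq_zero_of_projective _)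
    (add_zero 1)
  obtain ⟨φ, rfl⟩ := (Ext.mk₀_bijective (kernel g) Y).2 y
  let p : pushout (kernel.ι g) φ ⟶ X := pushout.desc g 0 (by simp)
  have hp : pushout.inl (kernel.ι g) φ ≫ p = g := pushout.inl_desc _ _ _
  have w : pushout.inr (kernel.ι g) φ ≫ p = 0 := pushout.inr_desc _ _ _
  have hp_epi : Epi p := by
    have : Epi (pushout.inl (kernel.ι g) φ ≫ p) := by rw [hp]; infer_instance
    exact epi_of_epi (pushout.inl (kernel.ι g) φ) p
  have hE : (ShortComplex.mk (pushout.inr (kernel.ι g) φ) p w).ShortExact :=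
    { exact := by
        refine ShortComplex.exact_of_g_is_cokernel _
          (CokernelCofork.IsColimit.ofπ' _ _ fun {Z} k hk => ?_)
        have h1 : kernel.ι g ≫ pushout.inl (kernel.ι g) φ ≫ k = 0 := by
          rw [pushout.condition_assoc]
          erw [hk]
          rw [comp_zero]
        refine ⟨hS.exact.desc (pushout.inl (kernel.ι g) φ ≫ k) h1, ?_⟩
        have h2 : g ≫ hS.exact.desc (pushout.inl (kernel.ι g) φ ≫ k) h1 =
          pushout.inl (kernel.ι g) φ ≫ k := hS.exact.g_desc _ _
        refine pushout.hom_ext ?_ ?_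
        · refine Eq.trans ?_ h2
          rw [← Category.assoc]
          exact congrArg (· ≫ _) hp
        · rw [← Category.assoc]
          exact (congrArg (· ≫ _) w).trans (zero_comp.trans hk.symm)
      mono_f := inferInstanceAs (Mono (pushout.inr (kernel.ι g) φ))
      epi_g := hp_epi }
  obtain ⟨s, hs⟩ := h _ _ _ w hE
  have hr := (ShortComplex.Splitting.ofExactOfSection _ hE.exact s hs hE.mono_f).f_r
  set r := (ShortComplex.Splitting.ofExactOfSection _ hE.exact s hs hE.mono_f).r
  have h3 : φ = kernel.ι g ≫ pushout.inl (kernel.ι g) φ ≫ r := by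
    rw [pushout.condition_assoc]
    exact (Category.comp_id φ).symm.trans (congrArg (φ ≫ ·) hr.symm)
  rw [h3, ← Ext.mk₀_comp_mk₀]
  exact hS.extClass_comp_assoc _

end ExtLifting

/-! ### Finite products as biproducts -/

section FiniteProducts

variable {C : Type u} [Category.{v} C] [Abelian C]

theorem pi_total {ι : Type*} [Fintype ι] [DecidableEq ι] (F : ι → C) :
    ∑ k, Limits.Pi.π F k ≫ Pi.ι F k = 𝟙 (∏ᶜ F) := by
  refine Pi.hom_ext _ _ fun j => ?_
  rw [Preadditive.sum_comp, Finset.sum_eq_single j, Category.assoc, Pi.ι_π_eq_id,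
    Category.comp_id, Category.id_comp]
  · intro k _ hk
    rw [Category.assoc, Pi.ι_π_of_ne F hk, comp_zero]
  · simp

theorem pi_hom_ext' {ι : Type*} [Finite ι] [DecidableEq ι] {F : ι → C} {Y : C} {f g : ∏ᶜ F ⟶ Y}
    (h : ∀ k, Pi.ι F k ≫ f = Pi.ι F k ≫ g) : f = g := by
  have := Fintype.ofFinite ι
  rw [← Category.id_comp f, ← Category.id_comp g, ← pi_total]
  simp only [Preadditive.sum_comp, Category.assoc, h]

end FiniteProducts

/-! ### Choice by well-founded recursion -/

section WellFounded

theorem exists_dependent_of_wellFounded {ι : Type*} {r : ι → ι → Prop} (hr : WellFounded r)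
    {H : ι → Type*} (P : ∀ i, (∀ j, r j i → H j) → H i → Prop) (hP : ∀ i f, ∃ x, P i f x) :
    ∃ h : ∀ i, H i, ∀ i, P i (fun j _ => h j) (h i) := by
  choose F hF using hP
  refine ⟨hr.fix F, fun i => ?_⟩
  have := hF i fun j _ => hr.fix F j
  rw [WellFounded.fix_eq]
  exact this

end WellFounded

/-! ### Paths in a finite acyclic quiver -/

section Paths

variable (Q : Type w) [Quiver.{w'} Q]

theorem wellFounded_successor [IsFiniteQuiver Q] [IsAcyclicQuiver Q] :
    WellFounded fun j i : Q => ∃ p : Quiver.Path i j, 0 < p.length := by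
  let r : Q → Q → Prop := fun j i => ∃ p : Quiver.Path i j, 0 < p.length
  have : Finite Q := IsFiniteQuiver.finite_vertices
  have : IsTrans Q r := ⟨fun a b c ⟨p, hp⟩ ⟨q, hq⟩ => ⟨q.comp p, by
    rw [Quiver.Path.length_comp]; omega⟩⟩
  have : Std.Irrefl r := ⟨fun a ⟨p, hp⟩ => by
    have := IsAcyclicQuiver.length_eq_zero a p; omega⟩
  exact Finite.wellFounded_of_trans_of_irrefl r

variable {Q}

/-- A path of positive length determines its first arrow and the remaining path. Paths are built by
appending arrows at the end, hence the induction on the remainder. -/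
theorem toPath_comp_injective {i l : Q} : Function.Injective
    fun y : Σ x : (Σ j : Q, (i ⟶ j)), Quiver.Path x.1 l => y.1.2.toPath.comp y.2 := by
  rintro ⟨⟨j, a⟩, q⟩ ⟨⟨k, b⟩, r⟩ h
  induction q with
  | nil =>
    cases r with
    | nil => cases h; rfl
    | cons r e =>
      have := congrArg Quiver.Path.length h
      simp [Quiver.Path.length_comp] at this
  | cons q e ih =>
    cases r with
    | nil =>
      have := congrArg Quiver.Path.length h
      simp [Quiver.Path.length_comp] at this
    | cons r e' =>
      simp only [Quiver.Path.comp_cons] at h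
      obtain rfl := Quiver.Path.obj_eq_of_cons_eq_cons h
      have h1 := eq_of_heq (Quiver.Path.heq_of_cons_eq_cons h)
      obtain rfl := eq_of_heq (Quiver.Path.hom_heq_of_cons_eq_cons h)
      cases ih _ h1
      rfl

end Paths

/-! ### The coinduced representations `e_i^ρ(T)` -/

section Coinduced

variable {A : Type u} [Category.{v} A] [Abelian A]
variable {J : Type w} [Category.{w'} J] [∀ i j : J, Finite (i ⟶ j)]

/-- The projection of a coinduced object onto the factor indexed by a morphism. -/
noncomputable def coindProj {i j : J} (T : A) (q : j ⟶ i) :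
    ((evaluationRightAdjoint A i).obj T).obj j ⟶ T :=
  Limits.Pi.π (fun _ : j ⟶ i => T) q

open Classical in
/-- The inclusion into a coinduced object of the factor indexed by a morphism. -/
noncomputable def coindIncl {i j : J} (T : A) (q : j ⟶ i) :
    T ⟶ ((evaluationRightAdjoint A i).obj T).obj j :=
  Pi.ι (fun _ : j ⟶ i => T) q

theorem coindIncl_proj {i j : J} (T : A) (q : j ⟶ i) : coindIncl T q ≫ coindProj T q = 𝟙 T := by
  classical
  exact Pi.ι_π_eq_id (fun _ : j ⟶ i => T) q

theorem coindIncl_proj_of_ne {i j : J} (T : A) {q q' : j ⟶ i} (h : q ≠ q') :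
    coindIncl T q ≫ coindProj T q' = 0 := by
  classical
  exact Pi.ι_π_of_ne (fun _ : j ⟶ i => T) h

theorem coind_hom_ext {i j : J} {T X : A}
    {f g : X ⟶ ((evaluationRightAdjoint A i).obj T).obj j}
    (h : ∀ q : j ⟶ i, f ≫ coindProj T q = g ≫ coindProj T q) : f = g :=
  Pi.hom_ext (f := fun _ : j ⟶ i => T) _ _ h

theorem exists_coind_lift {i j : J} {T X : A} (f : (j ⟶ i) → (X ⟶ T)) :
    ∃ l : X ⟶ ((evaluationRightAdjoint A i).obj T).obj j, ∀ q, l ≫ coindProj T q = f q :=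
  ⟨Pi.lift (f := fun _ : j ⟶ i => T) f, fun q => Pi.lift_π (f := fun _ : j ⟶ i => T) f q⟩

theorem coind_total {i j : J} [Fintype (j ⟶ i)] (T : A) :
    ∑ q : j ⟶ i, coindProj T q ≫ coindIncl T q = 𝟙 _ := by
  classical
  exact pi_total (fun _ : j ⟶ i => T)

theorem coind_hom_ext' {i j : J} {T X : A}
    {f g : ((evaluationRightAdjoint A i).obj T).obj j ⟶ X}
    (h : ∀ q : j ⟶ i, coindIncl T q ≫ f = coindIncl T q ≫ g) : f = g := by
  classical
  exact pi_hom_ext' (F := fun _ : j ⟶ i => T) h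

theorem coind_map_app_proj {i j : J} {S T : A} (h : S ⟶ T) (q : j ⟶ i) :
    ((evaluationRightAdjoint A i).map h).app j ≫ coindProj T q = coindProj S q ≫ h :=
  Pi.lift_π (f := fun _ : j ⟶ i => T) _ _

theorem coindIncl_map_app {i j : J} {S T : A} (h : S ⟶ T) (q : j ⟶ i) :
    coindIncl S q ≫ ((evaluationRightAdjoint A i).map h).app j = h ≫ coindIncl T q := by
  refine coind_hom_ext fun q' => ?_
  rw [Category.assoc, Category.assoc, coind_map_app_proj]
  by_cases hq : q = q'
  · subst hq
    rw [coindIncl_proj, reassoc_of% @coindIncl_proj, Category.comp_id]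
  · rw [coindIncl_proj_of_ne _ hq, reassoc_of% (coindIncl_proj_of_ne _ hq), zero_comp, comp_zero]

theorem coind_obj_map_proj {i j k : J} (T : A) (a : j ⟶ k) (q : k ⟶ i) :
    ((evaluationRightAdjoint A i).obj T).map a ≫ coindProj T q = coindProj T (a ≫ q) :=
  Pi.lift_π (f := fun _ : k ⟶ i => T) _ _

instance evaluationRightAdjoint_additive (i : J) :
    (evaluationRightAdjoint A i).Additive where
  map_add {S T f g} := by
    ext j
    refine coind_hom_ext fun q => ?_
    rw [NatTrans.app_add, Preadditive.add_comp, coind_map_app_proj, coind_map_app_proj,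
      coind_map_app_proj, Preadditive.comp_add]

theorem epi_coind_map {i : J} {S T : A} (h : S ⟶ T) [Epi h] :
    Epi ((evaluationRightAdjoint A i).map h) := by
  have : ∀ j, Epi (((evaluationRightAdjoint A i).map h).app j) := fun j => by
    refine ⟨fun f g hfg => coind_hom_ext' fun q => ?_⟩
    rw [← cancel_epi h, ← reassoc_of% @coindIncl_map_app, ← reassoc_of% @coindIncl_map_app, hfg]
  exact NatTrans.epi_of_epi_app _

theorem add_coind {P : ObjectProperty A} {T : A} (hT : add P T) (i j : J) :
    add P (((evaluationRightAdjoint A i).obj T).obj j) := by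
  have := Fintype.ofFinite (j ⟶ i)
  exact add_of_sum (fun _ : j ⟶ i => T) (fun _ => hT) _ _ (coind_total T)

/-- Since `e_i^ρ(T)_j` is a finite biproduct of copies of `T`, families of morphisms `e_i^ρ(T)_j ⟶
X_j` amount to morphisms from `T` to the product of the `X_j` over all `j ⟶ i`. Naturality is a
linear condition, cut out by the kernel of `δ`. -/
theorem exists_universal_from_coind [Finite J] (i : J) (X : J ⥤ A) :
    ∃ (R : A) (ε : (evaluationRightAdjoint A i).obj R ⟶ X),
      ∀ (T : A) (φ : (evaluationRightAdjoint A i).obj T ⟶ X),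
        ∃ h : T ⟶ R, (evaluationRightAdjoint A i).map h ≫ ε = φ := by
  have : ∀ j : J, Fintype (j ⟶ i) := fun j => Fintype.ofFinite _
  let G := evaluationRightAdjoint A i
  let F : (Σ j : J, (j ⟶ i)) → A := fun x => X.obj x.1
  let ψ : ∀ j : J, (G.obj (∏ᶜ F)).obj j ⟶ X.obj j := fun j =>
    ∑ q : j ⟶ i, coindProj (∏ᶜ F) q ≫ Limits.Pi.π F ⟨j, q⟩
  have hψ : ∀ (j : J) (q : j ⟶ i), coindIncl (∏ᶜ F) q ≫ ψ j = Limits.Pi.π F ⟨j, q⟩ := by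
    intro j q
    rw [Preadditive.comp_sum, Finset.sum_eq_single q]
    · rw [reassoc_of% @coindIncl_proj]
    · intro q' _ hq
      rw [reassoc_of% (coindIncl_proj_of_ne _ hq.symm), zero_comp]
    · simp
  let d : ∀ {j k : J} (a : j ⟶ k), (G.obj (∏ᶜ F)).obj j ⟶ X.obj k := fun {j k} a =>
    (G.obj (∏ᶜ F)).map a ≫ ψ k - ψ j ≫ X.map a
  let δ : ∏ᶜ F ⟶ ∏ᶜ fun x : (Σ (j k : J), (j ⟶ k) × (j ⟶ i)) => X.obj x.2.1 :=
    Pi.lift fun x => coindIncl (∏ᶜ F) x.2.2.2 ≫ d x.2.2.1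
  have hδ : ∀ {T : A} (h : T ⟶ ∏ᶜ F), h ≫ δ = 0 ↔
      ∀ {j k : J} (a : j ⟶ k), (G.map h).app j ≫ d a = 0 := by
    intro T h
    have h1 : ∀ {j k : J} (a : j ⟶ k) (q : j ⟶ i), h ≫ δ ≫ Limits.Pi.π _ ⟨j, k, a, q⟩ =
        coindIncl T q ≫ (G.map h).app j ≫ d a := fun a q => by
      rw [Pi.lift_π, reassoc_of% @coindIncl_map_app]
    constructor
    · intro h0 j k a
      refine coind_hom_ext' fun q => ?_
      rw [comp_zero, ← h1, reassoc_of% h0, zero_comp]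
    · intro h0
      refine Pi.hom_ext _ _ fun ⟨j, k, a, q⟩ => ?_
      rw [Category.assoc, h1, h0, comp_zero, zero_comp]
  refine ⟨kernel δ,
    { app := fun j => (G.map (kernel.ι δ)).app j ≫ ψ j
      naturality := fun j k a => ?_ }, fun T φ => ?_⟩
  · have := (hδ (kernel.ι δ)).1 (kernel.condition δ) a
    rw [Preadditive.comp_sub, sub_eq_zero] at this
    rw [NatTrans.naturality_assoc, this, Category.assoc]
  · let h : T ⟶ ∏ᶜ F := Pi.lift fun x => coindIncl T x.2 ≫ φ.app x.1
    have h1 : ∀ j : J, (G.map h).app j ≫ ψ j = φ.app j := fun j => by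
      refine coind_hom_ext' fun q => ?_
      rw [reassoc_of% @coindIncl_map_app, hψ, Pi.lift_π]
    have h2 : h ≫ δ = 0 := (hδ h).2 fun {j k} a => by
      rw [Preadditive.comp_sub, sub_eq_zero, ← NatTrans.naturality_assoc, h1,
        reassoc_of% (h1 j), NatTrans.naturality]
    refine ⟨kernel.lift δ h h2, ?_⟩
    ext j
    have h4 : G.map (kernel.lift δ h h2) ≫ G.map (kernel.ι δ) = G.map h := by
      rw [← Functor.map_comp, kernel.lift_ι]
    rw [← h1, ← h4, NatTrans.comp_app, NatTrans.comp_app, Category.assoc]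

end Coinduced

/-! ### The map to the targets of the outgoing arrows -/

section OutMap

variable {A : Type u} [Category.{v} A] [Abelian A]
variable {Q : Type w} [Quiver.{w'} Q] [IsFiniteQuiver Q]

instance finite_arrows_from (i : Q) : Finite (Σ j : Q, (i ⟶ j)) := by
  have : Finite Q := IsFiniteQuiver.finite_vertices
  have : ∀ i j : Q, Finite (i ⟶ j) := IsFiniteQuiver.finite_arrows
  infer_instance

/-- The product of the objects of a representation at the targets of the arrows starting at `i`. -/
noncomputable abbrev outProd (M : QuiverRep Q A) (i : Q) : A :=
  ∏ᶜ fun x : (Σ j : Q, (i ⟶ j)) => M.obj ((Paths.of Q).obj x.1)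

/-- The morphism from the object at `i` to the objects at the targets of the arrows starting
at `i`. -/
noncomputable def outMap (M : QuiverRep Q A) (i : Q) :
    M.obj ((Paths.of Q).obj i) ⟶ outProd M i :=
  Pi.lift fun x => M.map ((Paths.of Q).map x.2)

/-- The morphism induced on `outProd` by a morphism of representations. -/
noncomputable def outProdMap {M N : QuiverRep Q A} (f : M ⟶ N) (i : Q) :
    outProd M i ⟶ outProd N i :=
  Limits.Pi.map fun x => f.app ((Paths.of Q).obj x.1)

theorem outMap_π (M : QuiverRep Q A) {i : Q} (x : Σ j : Q, (i ⟶ j)) :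
    outMap M i ≫ Limits.Pi.π _ x = M.map ((Paths.of Q).map x.2) :=
  Pi.lift_π _ _

theorem outProdMap_π {M N : QuiverRep Q A} (f : M ⟶ N) {i : Q} (x : Σ j : Q, (i ⟶ j)) :
    outProdMap f i ≫ Limits.Pi.π _ x = Limits.Pi.π _ x ≫ f.app ((Paths.of Q).obj x.1) :=
  Pi.map_π _ _

theorem outMap_naturality {M N : QuiverRep Q A} (f : M ⟶ N) (i : Q) :
    outMap M i ≫ outProdMap f i = f.app ((Paths.of Q).obj i) ≫ outMap N i := by
  refine Pi.hom_ext _ _ fun x => ?_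
  rw [Category.assoc, Category.assoc, outProdMap_π, outMap_π, reassoc_of% @outMap_π, NatTrans.naturality]

theorem epi_outProdMap {M N : QuiverRep Q A} (f : M ⟶ N) [Epi f] (i : Q) :
    Epi (outProdMap f i) := by
  dsimp only [outProdMap]
  infer_instance

/-- This map projects the copies of `T` indexed by all paths from `i` to `l` onto those indexed by
paths of positive length, so it is split. -/
theorem epi_outMap_coind [IsAcyclicQuiver Q] (l i : Q) (T : A) :
    Epi (outMap ((eRho l).obj T) i) := by
  classical
  let l' : Paths Q := (Paths.of Q).obj l
  let X : QuiverRep Q A := (evaluationRightAdjoint A l').obj T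
  change Epi (outMap X i)
  let I := Σ x : (Σ j : Q, (i ⟶ j)), ((Paths.of Q).obj x.1 ⟶ l')
  let c : I → ((Paths.of Q).obj i ⟶ l') := fun y => (Paths.of Q).map y.1.2 ≫ y.2
  have hc : Function.Injective c := toPath_comp_injective
  let pr : I → (outProd X i ⟶ T) := fun y => Limits.Pi.π _ y.1 ≫ coindProj T y.2
  obtain ⟨s, hs⟩ := exists_coind_lift (i := l') (j := (Paths.of Q).obj i) (T := T)
    -- The section is zero on the component of a path with no first arrow, that is, of the trivial
    -- path when `i = l`.
    fun p => if h : ∃ y, c y = p then pr h.choose else 0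
  have : s ≫ outMap X i = 𝟙 _ := by
    refine Pi.hom_ext _ _ fun x => ?_
    rw [Category.assoc, outMap_π, Category.id_comp]
    refine coind_hom_ext (i := l') fun q => ?_
    have h : ∃ y, c y = (Paths.of Q).map x.2 ≫ q := ⟨⟨x, q⟩, rfl⟩
    have h1 : h.choose = ⟨x, q⟩ := hc h.choose_spec
    have h2 := coind_obj_map_proj T ((Paths.of Q).map x.2) q
    refine (Category.assoc _ _ _).trans ((congrArg (s ≫ ·) h2).trans ((hs _).trans ?_))
    rw [dif_pos h, h1]
  have : IsSplitEpi (outMap X i) := ⟨⟨⟨s, this⟩⟩⟩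
  infer_instance

theorem epi_outMap_of_fac_add {P : ObjectProperty (QuiverRep Q A)} {M : QuiverRep Q A}
    (i : Q) (hP : ∀ X, P X → Epi (outMap X i)) (hM : Fac (add P) M) : Epi (outMap M i) := by
  obtain ⟨N, f, hN, hf⟩ := hM
  obtain ⟨n, F, p, q, hF, hsum⟩ := add_iff_exists_sum.1 hN
  refine Preadditive.epi_of_cancel_zero _ fun {Z} g hg => ?_
  have := epi_outProdMap f i
  rw [← cancel_epi (outProdMap f i), comp_zero]
  have h1 : ∀ k, outProdMap (q k) i ≫ outProdMap f i ≫ g = 0 := fun k => by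
    have := hP _ (hF k)
    rw [← cancel_epi (outMap (F k) i), reassoc_of% @outMap_naturality, reassoc_of% @outMap_naturality, hg]
    simp
  have h2 : ∑ k, outProdMap (p k) i ≫ outProdMap (q k) i = 𝟙 (outProd N i) := by
    refine Pi.hom_ext _ _ fun x => ?_
    have h3 := congrArg (fun t : N ⟶ N => t.app ((Paths.of Q).obj x.1)) hsum
    simp only [NatTrans.app_sum, NatTrans.comp_app, NatTrans.id_app] at h3
    simp only [Preadditive.sum_comp, Category.assoc, outProdMap_π, reassoc_of% @outProdMap_π]
    rw [← Preadditive.comp_sum, h3, Category.comp_id, Category.id_comp]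
  rw [← Category.id_comp (outProdMap f i), ← h2]
  simp [Preadditive.sum_comp, h1]

end OutMap

/-! ### The support `τ`-tilting axioms for representations -/

section Representations

variable {C : Type*} [Category* C] [Abelian C]

theorem shortExact_fac_kernel {P : ObjectProperty C} {S : ShortComplex C} (hS : S.ShortExact)
    (h : Fac P S.X₁) : Fac P (kernel S.g) :=
  fac_of_epi h (hS.fIsKernel.conePointUniqueUpToIso (kernelIsKernel S.g)).hom

theorem add_cokernel_of_retraction {P : ObjectProperty C} {X E : C} (η : X ⟶ E) (ρ : E ⟶ X)
    (h : η ≫ ρ = 𝟙 X) (hE : add P E) : add P (cokernel η) := by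
  refine add_of_retract hE (cokernel.desc η (𝟙 E - ρ ≫ η) (by simp [reassoc_of% h]))
    (cokernel.π η) ?_
  rw [← cancel_epi (cokernel.π η)]
  simp

theorem exists_lift_of_add_of_fac {P : ObjectProperty C}
    (hP : ∀ ⦃T Y : C⦄, P T → Fac P Y → ExtOneVanishes T Y) {X E N : C} (hX : add P X)
    (g : E ⟶ N) [Epi g] (hg : Fac P (kernel g)) (f : X ⟶ N) : ∃ k : X ⟶ E, k ≫ g = f :=
  exists_lift_of_add g (fun _ hT h => (hP hT hg).exists_lift g h) hX f

variable {A : Type u} [Category.{v} A] [Abelian A]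
variable {Q : Type w} [Quiver.{w'} Q] [IsFiniteQuiver Q] [IsAcyclicQuiver Q]

theorem exists_eq_coind_of_rhoObjects {𝒯 : ObjectProperty A} {X : QuiverRep Q A}
    (hX : rhoObjects Q 𝒯 X) :
    ∃ (i : Paths Q) (T : A), 𝒯 T ∧ X = (evaluationRightAdjoint A i).obj T :=
  hX

theorem add_rhoObjects_coind {𝒯 : ObjectProperty A} (i : Paths Q) {T : A} (hT : add 𝒯 T) :
    add (rhoObjects Q 𝒯) ((evaluationRightAdjoint A i).obj T) :=
  add_map (P' := rhoObjects Q 𝒯) (evaluationRightAdjoint A i)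
    (fun T hT => add_of_prop ⟨i, T, hT, rfl⟩) hT

theorem add_obj_of_add_rhoObjects {𝒯 : ObjectProperty A} {X : QuiverRep Q A}
    (hX : add (rhoObjects Q 𝒯) X) (j : Paths Q) : add 𝒯 (X.obj j) := by
  refine add_map (P' := 𝒯) ((evaluation (Paths Q) A).obj j) ?_ hX
  rintro _ ⟨i, T, hT, rfl⟩
  exact add_coind (J := Paths Q) (add_of_prop hT) i j

theorem fac_obj_of_fac_add_rhoObjects {𝒯 : ObjectProperty A} [𝒯.IsClosedUnderFiniteCoproducts]
    {X : QuiverRep Q A} (hX : Fac (add (rhoObjects Q 𝒯)) X) (j : Paths Q) :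
    Fac 𝒯 (X.obj j) := by
  obtain ⟨T, f, hT, hf⟩ := hX
  exact fac_of_epi (fac_of_add (add_obj_of_add_rhoObjects hT j)) (f.app j)

/-- The condition on `N` is only vertexwise, which is weaker than membership in `add (rhoObjects Q
𝒯)`; the splitting in `exists_sequence_add_rhoObjects` needs this generality. -/
theorem extOneVanishes_of_fac_add_rhoObjects [EnoughProjectives A] {𝒯 : ObjectProperty A}
    [𝒯.IsClosedUnderFiniteCoproducts]
    (hExt : ∀ ⦃T Y : A⦄, 𝒯 T → Fac 𝒯 Y → ExtOneVanishes T Y)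
    (hFac : IsClosedUnderKernelsOfEpis (Fac 𝒯)) {N M : QuiverRep Q A}
    (hN : ∀ i, add 𝒯 (N.obj i)) (hM : Fac (add (rhoObjects Q 𝒯)) M) : ExtOneVanishes N M := by
  refine extOneVanishes_of_exists_section fun E ι p w hE => ?_
  have hM' := fac_obj_of_fac_add_rhoObjects hM
  have ht : ∀ i : Q, Epi (outMap M i) := fun i => by
    refine epi_outMap_of_fac_add i ?_ hM
    rintro _ ⟨l, T, -, rfl⟩
    exact epi_outMap_coind l i T
  have hK : ∀ i : Q, Fac 𝒯 (kernel (outMap M i)) := fun i =>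
    hFac _ (ht i) (hM' _) (fac_piObj _ fun x => hM' _)
  have hEi := fun i : Paths Q => hE.map_of_exact ((evaluation (Paths Q) A).obj i)
  have hσ : ∀ i : Paths Q, ∃ s : N.obj i ⟶ E.obj i, s ≫ p.app i = 𝟙 _ := fun i => by
    have : Epi (p.app i) := (hEi i).epi_g
    exact exists_lift_of_add_of_fac hExt (hN i) (p.app i) (shortExact_fac_kernel (hEi i) (hM' i)) _
  choose σ hσ using hσ
  -- `c` measures the failure of the vertexwise sections `σ` to commute with the structure maps.
  have hc : ∀ (i j : Paths Q) (a : i ⟶ j), ∃ c : N.obj i ⟶ M.obj j,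
      c ≫ ι.app j = σ i ≫ E.map a - N.map a ≫ σ j := fun i j a => by
    have : Mono (((ShortComplex.mk ι p w).map ((evaluation (Paths Q) A).obj j)).f) :=
      (hEi j).mono_f
    have h0 : (σ i ≫ E.map a - N.map a ≫ σ j) ≫ p.app j = 0 := by
      rw [Preadditive.sub_comp, Category.assoc, Category.assoc, p.naturality, hσ,
        reassoc_of% (hσ i), Category.comp_id, sub_self]
    exact ⟨(hEi j).exact.lift _ h0, (hEi j).exact.lift_f _ h0⟩
  choose c hc using hc
  -- The correction `h` is chosen so that `σ - h ≫ ι` is natural. Once `h` is known at all proper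
  -- successors of `i`, the equations for the arrows leaving `i` ask for one lift along `outMap M
  -- i`, which exists since `Ext¹(𝒯, Fac 𝒯) = 0`.
  obtain ⟨h, hh⟩ := exists_dependent_of_wellFounded (wellFounded_successor Q)
    (H := fun i => N.obj ((Paths.of Q).obj i) ⟶ M.obj ((Paths.of Q).obj i))
    (fun i f x => ∀ (j : Q) (a : i ⟶ j), x ≫ M.map ((Paths.of Q).map a) =
      c _ _ ((Paths.of Q).map a) + N.map ((Paths.of Q).map a) ≫ f j ⟨a.toPath, by simp⟩) (fun i f => by
    have := ht i
    let b : ∀ y : (Σ j : Q, (i ⟶ j)),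
        N.obj ((Paths.of Q).obj i) ⟶ M.obj ((Paths.of Q).obj y.1) := fun ⟨j, a⟩ =>
      c _ _ ((Paths.of Q).map a) + N.map ((Paths.of Q).map a) ≫ f j ⟨a.toPath, by simp⟩
    obtain ⟨x, hx⟩ := exists_lift_of_add_of_fac hExt (hN ((Paths.of Q).obj i)) (outMap M i) (hK i)
      (Pi.lift b)
    refine ⟨x, fun j a => ?_⟩
    have := congrArg (fun t : _ ⟶ outProd M i => t ≫ Limits.Pi.π _ (⟨j, a⟩ : Σ j : Q, (i ⟶ j))) hx
    simpa only [Category.assoc, outMap_π, Pi.lift_π] using this)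
  have hnat : ∀ {i j : Q} (a : i ⟶ j), N.map ((Paths.of Q).map a) ≫
      (σ ((Paths.of Q).obj j) - h j ≫ ι.app ((Paths.of Q).obj j)) =
      (σ ((Paths.of Q).obj i) - h i ≫ ι.app ((Paths.of Q).obj i)) ≫
        E.map ((Paths.of Q).map a) := by
    intro i j a
    have h1 := hh i j a
    have h2 := hc _ _ ((Paths.of Q).map a)
    rw [Preadditive.sub_comp, Preadditive.comp_sub, Category.assoc, ← ι.naturality,
      reassoc_of% h1, Preadditive.add_comp, h2, Category.assoc]
    abel
  refine ⟨Paths.liftNatTrans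
    (fun i => σ ((Paths.of Q).obj i) - h i ≫ ι.app ((Paths.of Q).obj i)) hnat, ?_⟩
  ext i
  have h3 : ι.app i ≫ p.app i = 0 := by
    rw [← NatTrans.comp_app, w]; rfl
  have h4 : (σ i - (show N.obj i ⟶ M.obj i from h i) ≫ ι.app i) ≫ p.app i = 𝟙 _ := by
    rw [Preadditive.sub_comp, Category.assoc, h3, comp_zero, sub_zero, hσ]
  exact h4

theorem contravariantlyFinite_add_rhoObjects {𝒯 : ObjectProperty A}
    (h𝒯 : IsContravariantlyFinite 𝒯) : IsContravariantlyFinite (add (rhoObjects Q 𝒯)) := by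
  intro X
  have : Finite (Paths Q) := IsFiniteQuiver.finite_vertices (Q := Q)
  choose R ε hε using fun i : Paths Q => exists_universal_from_coind (A := A) i X
  choose T φ hφ using fun i : Paths Q => h𝒯 (R i)
  let G : Paths Q → A ⥤ QuiverRep Q A := fun i => evaluationRightAdjoint A i
  refine ⟨⨁ fun i => (G i).obj (T i), biproduct.desc fun i => (G i).map (φ i) ≫ ε i,
    add_biproduct _ fun i => add_rhoObjects_coind i (add_of_prop (hφ i).1), fun {X'} hX' f => ?_⟩
  refine exists_lift_of_add _ ?_ hX' f
  intro X₀ hX₀ f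
  obtain ⟨i, T', hT', rfl⟩ := exists_eq_coind_of_rhoObjects hX₀
  obtain ⟨h, hh⟩ := hε i T' f
  obtain ⟨k, hk⟩ := (hφ i).2 hT' h
  -- A morphism from `e_i^ρ(T')` first factors through `ε i`, and the resulting `T' ⟶ R i` through
  -- the approximation `φ i`.
  refine ⟨(G i).map k ≫ biproduct.ι (fun i => (G i).obj (T i)) i, ?_⟩
  rw [Category.assoc, biproduct.ι_desc, ← Functor.map_comp_assoc, hk]
  exact hh

theorem exists_sequence_add_rhoObjects [EnoughProjectives A] {𝒯 : ObjectProperty A}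
    (h𝒯 : IsSupportTauTilting 𝒯) (hFac : IsClosedUnderKernelsOfEpis (Fac 𝒯))
    (P : QuiverRep Q A) (hP : Projective P) :
    ∃ (T₀ T₁ : QuiverRep Q A) (f : P ⟶ T₀) (g : T₀ ⟶ T₁) (w : f ≫ g = 0),
      add (rhoObjects Q 𝒯) T₀ ∧ add (rhoObjects Q 𝒯) T₁ ∧ (ShortComplex.mk f g w).Exact ∧
        Epi g ∧ IsLeftApproximation (add (rhoObjects Q 𝒯)) f := by
  have := h𝒯.additive
  have : Finite (Paths Q) := IsFiniteQuiver.finite_vertices (Q := Q)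
  let G : Paths Q → A ⥤ QuiverRep Q A := fun i => evaluationRightAdjoint A i
  let ev : Paths Q → QuiverRep Q A ⥤ A := fun i => (evaluation (Paths Q) A).obj i
  let adj : ∀ i, ev i ⊣ G i := fun i => evaluationAdjunctionLeft A i
  have hPi : ∀ i, Projective ((ev i).obj P) := fun i => by
    have : (G i).PreservesEpimorphisms := ⟨fun f _ => epi_coind_map f⟩
    exact (adj i).map_projective P hP
  choose T T' φ _ _ hT _ _ _ hφ using fun i => h𝒯.exists_sequence ((ev i).obj P) (hPi i)
  let f : P ⟶ ⨁ fun i => (G i).obj (T i) := biproduct.lift fun i => (adj i).homEquiv _ _ (φ i)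
  have hT₀ : add (rhoObjects Q 𝒯) (⨁ fun i => (G i).obj (T i)) :=
    add_biproduct _ fun i => add_rhoObjects_coind i (add_of_prop (hT i))
  have hf : IsLeftApproximation (add (rhoObjects Q 𝒯)) f := by
    refine ⟨hT₀, fun {X'} hX' h => exists_factor_of_add f ?_ hX' h⟩
    intro X₀ hX₀ h
    obtain ⟨i, S, hS, rfl⟩ := exists_eq_coind_of_rhoObjects hX₀
    obtain ⟨k, hk⟩ := (hφ i).2 hS (((adj i).homEquiv _ _).symm h)
    refine ⟨biproduct.π (fun i => (G i).obj (T i)) i ≫ (G i).map k, ?_⟩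
    rw [biproduct.lift_π_assoc, ← Adjunction.homEquiv_naturality_right, hk,
      Equiv.apply_symm_apply]
  -- Followed by a projection and the counit, `f` at `i` gives back `φ i`. Hence every morphism from
  -- `P_i` to an object of `𝒯` factors through `f` at `i`, and `IsSupportTauTilting.add_cokernel`
  -- applies.
  have hC : ∀ i, add 𝒯 ((ev i).obj (cokernel f)) := fun i => by
    refine add_of_iso (h𝒯.add_cokernel (hPi i) ((ev i).map f) (add_obj_of_add_rhoObjects hT₀ i)
      fun {S} hS h => ?_) (PreservesCokernel.iso (ev i) f)
    obtain ⟨k, hk⟩ := (hφ i).2 hS h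
    refine ⟨(ev i).map (biproduct.π _ i) ≫ (adj i).counit.app (T i) ≫ k, ?_⟩
    have h1 : (ev i).map ((adj i).homEquiv _ _ (φ i)) ≫ (adj i).counit.app (T i) = φ i :=
      ((adj i).homEquiv_counit _ _ _).symm.trans (Equiv.symm_apply_apply _ _)
    rw [← Functor.map_comp_assoc, biproduct.lift_π, reassoc_of% h1, hk]
  have hCFac : Fac (add (rhoObjects Q 𝒯)) (cokernel f) :=
    ⟨_, cokernel.π f, hT₀, inferInstance⟩
  let E : QuiverRep Q A := ⨁ fun i => (G i).obj ((ev i).obj (cokernel f))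
  let η : cokernel f ⟶ E := biproduct.lift fun i => (adj i).unit.app (cokernel f)
  have hE : add (rhoObjects Q 𝒯) E := add_biproduct _ fun i => add_rhoObjects_coind i (hC i)
  -- By the triangle identity the counits retract `η` at each vertex; the `ρ i` need not be
  -- compatible with the arrows.
  let ρ : ∀ i, (ev i).obj E ⟶ (ev i).obj (cokernel f) := fun i =>
    (ev i).map (biproduct.π _ i) ≫ (adj i).counit.app _
  have hρ : ∀ i, (ev i).map η ≫ ρ i = 𝟙 _ := fun i => by
    rw [← Functor.map_comp_assoc, biproduct.lift_π, Adjunction.left_triangle_components]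
  have hη : Mono η := by
    have : ∀ i, Mono (η.app i) := fun i => by
      have : IsSplitMono (η.app i) := ⟨⟨⟨ρ i, hρ i⟩⟩⟩
      infer_instance
    exact NatTrans.mono_of_mono_app _
  have hN : ∀ i, add 𝒯 ((cokernel η).obj i) := fun i =>
    add_of_iso (add_cokernel_of_retraction ((ev i).map η) (ρ i) (hρ i)
      (add_obj_of_add_rhoObjects hE i)) (PreservesCokernel.iso (ev i) η)
  have hS : (ShortComplex.mk η (cokernel.π η) (cokernel.condition η)).ShortExact :=
    { exact := ShortComplex.exact_cokernel η
      mono_f := hη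
      epi_g := (inferInstance : Epi (cokernel.π η)) }
  -- The kernel of `cokernel.π η` is `cokernel f` up to isomorphism, hence a quotient of `T₀`. The
  -- vanishing of Ext splits `η` globally and exhibits `cokernel f` as a summand of `E`.
  obtain ⟨s, hs⟩ := (extOneVanishes_of_fac_add_rhoObjects h𝒯.ext_vanishes hFac hN
    (shortExact_fac_kernel hS hCFac)).exists_lift (cokernel.π η) (𝟙 _)
  let split := ShortComplex.Splitting.ofExactOfSection _ hS.exact s hs hη
  exact ⟨_, cokernel f, f, cokernel.π f, cokernel.condition f, hT₀,
    add_of_retract hE η split.r split.f_r, ShortComplex.exact_cokernel f, inferInstance, hf⟩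

end Representations

end TauTilting

theorem mainTheorem3 {A : Type u} [Category.{v} A] [Abelian A] [EnoughProjectives A]
    {Q : Type w} [Quiver.{w'} Q] [TauTilting.IsFiniteQuiver Q] [TauTilting.IsAcyclicQuiver Q]
    (𝒯 : ObjectProperty A) (h𝒯 : TauTilting.IsSupportTauTilting 𝒯)
    (hFac : TauTilting.IsClosedUnderKernelsOfEpis (TauTilting.Fac 𝒯)) :
    TauTilting.IsSupportTauTilting (TauTilting.add (TauTilting.rhoObjects Q 𝒯)) := by
  have := h𝒯.additive
  exact
    { additive := TauTilting.add_isClosedUnderFiniteCoproducts _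
      contravariantlyFinite :=
        TauTilting.contravariantlyFinite_add_rhoObjects h𝒯.contravariantlyFinite
      ext_vanishes := fun _ _ hT hY =>
        TauTilting.extOneVanishes_of_fac_add_rhoObjects h𝒯.ext_vanishes hFac
          (TauTilting.add_obj_of_add_rhoObjects hT) hY
      exists_sequence := TauTilting.exists_sequence_add_rhoObjects h𝒯 hFac }
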